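/- Let $\mathbb K\in\{\mathbb R,\mathbb C\}$, let $N\ge 2$, and let $X$ be $\ell^p$ for some $1\le p<\infty$ or $c_0$ (sequences in $\mathbb K$ indexed by $\mathbb N=\{1,2,\dots\}$, usual norms). For $1\le j\le N$ let $(w_{j,n})_{n\in\mathbb N}$ be a sequence of positive reals and let $T_j$ be the (possibly unbounded) unilateral weighted backward shift $T_j(x_n)_{n}=(w_{j,n}x_{n+1})_{n}$ with maximal domain $D(T_j)=\{x\in X: (w_{j,n}x_{n+1})_n\in X\}$. Suppose that there is a bounded sequence $(a_n)_{n\in\mathbb N}$ of positive reals such that $$B_{j,k}:=\sup_{n\in\mathbb N}\Bigl[a_{k+n}\prod_{i=n}^{k+n-1}w_{j,i}\Bigr]<\infty\qquad\text{for all }k\in\mathbb N,\ 1\le j\le N.$$ Assume that one of the following holds: (i) $X=\ell^p$ with $p\ne 2$, or $X=c_0$, and $\sum_{k=1}^\infty 1/B_{j,k}<\infty$ for each $j$; (ii) $X=\ell^2$ and $\sum_{k=1}^\infty 1/B_{j,k}^2<\infty$ for each $j$. Then $T_1,\dots,T_N$ are densely $(d,1)$-distributionally chaotic, that is: there exist an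 uncountable dense set $S\subseteq X$ with $S\subseteq\bigcap_{j=1}^N\bigcap_{k\ge1}D(T_j^k)$ and $\sigma>0$ such that for every $\epsilon>0$ and all distinct $x,y\in S$, $$\overline{\mathrm{dens}}\Bigl(\bigcap_{j=1}^N\{k\in\mathbb N:\|T_j^kx-T_j^ky\|\ge\sigma\}\Bigr)=1\quad\text{and}\quad \overline{\mathrm{dens}}\Bigl(\bigcap_{j=1}^N\{k\in\mathbb N:\|T_j^kx-T_j^ky\|<\epsilon\}\Bigr)=1,$$ where $\overline{\mathrm{dens}}(D)=\limsup_{n\to\infty}\operatorname{card}(D\cap[1,n])/n$. -/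

import Mathlib

open Filter Topology
open scoped ENNReal

noncomputable section

/-- The upper density `limsup_{n → ∞} card (D ∩ [1, n]) / n` of a set `D` of natural numbers. -/
def upperDens (D : Set ℕ) : ℝ :=
  limsup (fun n : ℕ => ((D ∩ Set.Icc 1 n).ncard : ℝ) / n) atTop

/-- A multivalued linear operator from `X` to `Y` is identified with its graph, a linear
subspace of `X × Y`: `y` is a value of `A` at `x` iff `(x, y) ∈ A`. -/
abbrev MLO (𝕜 X Y : Type*) [Semiring 𝕜] [AddCommMonoid X] [AddCommMonoid Y] [Module 𝕜 X]
    [Module 𝕜 Y] := Submodule 𝕜 (X × Y)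

namespace MLO

/-- The domain `{x | A x ≠ ∅}`. -/
def domain {𝕜 X Y : Type*} [Semiring 𝕜] [AddCommMonoid X] [AddCommMonoid Y] [Module 𝕜 X]
    [Module 𝕜 Y] (A : MLO 𝕜 X Y) : Set X :=
  {x | ∃ y, (x, y) ∈ A}

/-- The product `B A` (first `A`, then `B`), with domain `{x ∈ D(A) | D(B) ∩ A x ≠ ∅}`. -/
def comp {𝕜 X Y Z : Type*} [Semiring 𝕜] [AddCommMonoid X] [AddCommMonoid Y] [AddCommMonoid Z]
    [Module 𝕜 X] [Module 𝕜 Y] [Module 𝕜 Z] (B : MLO 𝕜 Y Z) (A : MLO 𝕜 X Y) : MLO 𝕜 X Z where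
  carrier := {q | ∃ y, (q.1, y) ∈ A ∧ (y, q.2) ∈ B}
  add_mem' := by
    rintro q r ⟨y, h1, h2⟩ ⟨z, h3, h4⟩
    exact ⟨y + z, A.add_mem h1 h3, B.add_mem h2 h4⟩
  zero_mem' := ⟨0, A.zero_mem, B.zero_mem⟩
  smul_mem' := by
    rintro c q ⟨y, h1, h2⟩
    exact ⟨c • y, A.smul_mem c h1, B.smul_mem c h2⟩

/-- The powers `A ^ 0 = I`, `A ^ (k + 1) = A (A ^ k)`. -/
def pow {𝕜 X : Type*} [Semiring 𝕜] [AddCommMonoid X] [Module 𝕜 X] (A : MLO 𝕜 X X) :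
    ℕ → MLO 𝕜 X X
  | 0 => (LinearMap.id : X →ₗ[𝕜] X).graph
  | k + 1 => comp A (pow A k)

end MLO

/-- Dense disjoint (type 1) distributional chaos of a tuple of sequences
`((A j k)_{k ≥ 1})_{1 ≤ j ≤ N}` of multivalued linear operators from `X` to `Y`: there are a
dense uncountable set `S`, contained in all the domains, and `σ > 0`, such that for each `ε > 0`
and each pair of distinct points `x, y ∈ S` one can select values `u j k ∈ A j k x` and
`v j k ∈ A j k y` for which both sets of indices `k` below have upper density one.
(The values of `u` and `v` at the index `k = 0` play no role.) -/
def IsDenselyD1DistribChaoticSeq {𝕜 X Y : Type*} [RCLike 𝕜] [NormedAddCommGroup X]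
    [NormedSpace 𝕜 X] [NormedAddCommGroup Y] [NormedSpace 𝕜 Y] {N : ℕ}
    (A : Fin N → ℕ → MLO 𝕜 X Y) : Prop :=
  ∃ S : Set X, ¬ S.Countable ∧ Dense S ∧ (∀ j, ∀ k, 1 ≤ k → S ⊆ (A j k).domain) ∧
    ∃ σ : ℝ, 0 < σ ∧ ∀ ε : ℝ, 0 < ε → ∀ x ∈ S, ∀ y ∈ S, x ≠ y →
      ∃ u v : Fin N → ℕ → Y,
        (∀ j, ∀ k, 1 ≤ k → (x, u j k) ∈ A j k ∧ (y, v j k) ∈ A j k) ∧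
        upperDens (⋂ j, {k | σ ≤ dist (u j k) (v j k)}) = 1 ∧
        upperDens (⋂ j, {k | dist (u j k) (v j k) < ε}) = 1

/-- Dense `(d,1)`-distributional chaos of a tuple `T 1, …, T N` of (possibly unbounded, single
valued) linear operators in `X`: this is the notion above for the sequences of their powers. -/
def IsDenselyD1DistribChaotic {𝕜 X : Type*} [RCLike 𝕜] [NormedAddCommGroup X]
    [NormedSpace 𝕜 X] {N : ℕ} (T : Fin N → (X →ₗ.[𝕜] X)) : Prop :=
  IsDenselyD1DistribChaoticSeq fun j k => MLO.pow (T j).graph k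

/-- The unilateral weighted backward shift `(x n)_n ↦ (w n * x (n + 1))_n` in `ℓ^p`, with its
maximal domain. Sequences are indexed by `0, 1, 2, …`. -/
def lpBackwardShift (𝕜 : Type*) [RCLike 𝕜] (p : ℝ≥0∞) (w : ℕ → ℝ) :
    lp (fun _ : ℕ => 𝕜) p →ₗ.[𝕜] lp (fun _ : ℕ => 𝕜) p where
  domain :=
    { carrier := {x | Memℓp (fun n => (w n : 𝕜) * x (n + 1)) p}
      add_mem' := by
        intro x y hx hy
        have h := Memℓp.add hx hy
        have e : (fun n => (w n : 𝕜) * (x + y) (n + 1)) =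
            (fun n => (w n : 𝕜) * x (n + 1)) + fun n => (w n : 𝕜) * y (n + 1) := by
          funext n
          simp [mul_add]
        rwa [Set.mem_ofPred_eq, e]
      zero_mem' := by
        have e : (fun n => (w n : 𝕜) * (0 : lp (fun _ : ℕ => 𝕜) p) (n + 1)) = 0 := by
          funext n
          simp
        rw [Set.mem_ofPred_eq, e]
        exact zero_memℓp
      smul_mem' := by
        intro c x hx
        have h := Memℓp.const_smul hx c
        have e : (fun n => (w n : 𝕜) * (c • x) (n + 1)) =
            c • fun n => (w n : 𝕜) * x (n + 1) := by
          funext n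
          simp [mul_left_comm]
        rwa [Set.mem_ofPred_eq, e] }
  toFun :=
    { toFun := fun x => ⟨fun n => (w n : 𝕜) * (x : lp (fun _ : ℕ => 𝕜) p) (n + 1), x.2⟩
      map_add' := by
        intro x y
        ext n
        exact mul_add _ _ _
      map_smul' := by
        intro c x
        ext n
        exact mul_left_comm _ _ _ }

/-- The space `c₀` of null sequences with the supremum norm (on the discrete space `ℕ`,
continuous functions vanishing at infinity are exactly the null sequences). -/
abbrev c0 (𝕜 : Type*) [RCLike 𝕜] := ZeroAtInftyContinuousMap ℕ 𝕜

/-- The unilateral weighted backward shift `(x n)_n ↦ (w n * x (n + 1))_n` in `c₀`, with its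
maximal domain. -/
def c0BackwardShift (𝕜 : Type*) [RCLike 𝕜] (w : ℕ → ℝ) : c0 𝕜 →ₗ.[𝕜] c0 𝕜 where
  domain :=
    { carrier := {x | Tendsto (fun n => (w n : 𝕜) * x (n + 1)) atTop (𝓝 0)}
      add_mem' := by
        intro x y hx hy
        have h := Tendsto.add hx hy
        simpa [mul_add] using h
      zero_mem' := by simp
      smul_mem' := by
        intro c x hx
        have h := Tendsto.const_mul c hx
        simpa [mul_left_comm] using h }
  toFun :=
    { toFun := fun x =>
        { toFun := fun n => (w n : 𝕜) * (x : c0 𝕜) (n + 1)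
          continuous_toFun := continuous_of_discreteTopology
          zero_at_infty' := by
            rw [cocompact_eq_cofinite, Nat.cofinite_eq_atTop]
            exact x.2 }
      map_add' := by
        intro x y
        ext n
        simp [mul_add]
      map_smul' := by
        intro c x
        ext n
        simp [mul_left_comm] }

/-- `B_k = sup_n a_{k+n} ∏_{i=n}^{k+n-1} w_i`. -/
def shiftSup (w a : ℕ → ℝ) (k : ℕ) : ℝ :=
  ⨆ n : ℕ, a (k + n) * ∏ i ∈ Finset.Ico n (k + n), w i

end

/-!
For the bounded diagonal operator `C x = (a n * x n)`, the compositions `T j ^ k ∘ C` are everywhere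
defined: up to a shift by `k` they multiply by the weight
`W j k n = a (k + n) * ∏ i ∈ Ico n (k + n), w j i`, whose supremum is `B j k`. Each of them has an
entry larger than `B j k / 2`, at some `n = s j k`, so that
`‖T j ^ k (C y)‖ ≥ (B j k / 2) * |y (s j k + k)|`. To make all these norms tend to infinity, it is
enough that `|y (s j k + k)| ^ q ≥ c k / B j k ^ q` with `c k → ∞`, where `q = 1` in the case of
`ℓ^p` and `c₀` and `q = 2` in the case of `ℓ²`. If `∑ 1 / B j k ^ q` converges, then so does
`∑ c k / B j k ^ q` for some `c → ∞`, and summing these demands over the indices that hit a given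
coordinate yields such a `y` in the space (`SolidSequenceSpace.exists_large_coord`). Because the
operators are weighted shifts, this replaces the plank theorems used for general operators, and real
and complex scalars are treated alike.

Since the `k`-th iterate only sees coordinates from `k` on, the restriction of `y` to a sparse union
of blocks has an orbit that is alternately large and small, jointly for all `j`, on windows
`(m, i * m]` with `i → ∞` (`SolidSequenceSpace.exists_block_restriction`); sets containing such
windows have upper density one. Finitely supported vectors have eventually vanishing orbits and
contain a dense sequence, so perturbing small multiples of the irregular vector by them gives a dense
uncountable scrambled set (`isDenselyD1DistribChaotic_of_irregular_orbit`).

The only properties of the spaces that matter are collected in `SolidSequenceSpace`.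
-/

/-! ### Upper density -/

/-- A set that contains the windows `(m i, i * m i]` for all large `i` has upper density one: the
window alone fills the proportion `1 - 1 / i` of `[1, i * m i]`. -/
theorem upperDens_eq_one_of_windows {D : Set ℕ} {m : ℕ → ℕ} (hm : ∀ i, i ≤ m i)
    (hD : ∀ᶠ i in atTop, ∀ k, m i < k → k ≤ i * m i → k ∈ D) : upperDens D = 1 := by
  have hle : ∀ n : ℕ, ((D ∩ Set.Icc 1 n).ncard : ℝ) / n ≤ 1 := by
    intro n
    refine div_le_one_of_le₀ ?_ (Nat.cast_nonneg n)
    have h := Set.ncard_le_ncard (Set.inter_subset_right (s := D) (t := Set.Icc 1 n))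
      (Set.finite_Icc 1 n)
    rw [← Finset.coe_Icc, Set.ncard_coe_finset, Nat.card_Icc] at h
    exact_mod_cast h
  have hnonneg : ∀ n : ℕ, 0 ≤ ((D ∩ Set.Icc 1 n).ncard : ℝ) / n := fun n => by positivity
  have hbdd : IsBoundedUnder (· ≤ ·) atTop
      fun n : ℕ => ((D ∩ Set.Icc 1 n).ncard : ℝ) / n := isBoundedUnder_of ⟨1, hle⟩
  refine le_antisymm ?_ ?_
  · exact limsup_le_of_le (isBoundedUnder_of ⟨0, hnonneg⟩).isCoboundedUnder_le
      (Eventually.of_forall hle)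
  · refine le_of_forall_lt fun c hc => ?_
    obtain ⟨c', hcc', hc'⟩ := exists_between hc
    refine hcc'.trans_le (le_limsup_of_frequently_le ?_ hbdd)
    rw [frequently_atTop]
    intro n₀
    have htend : Tendsto (fun i : ℕ => 1 - 1 / (i : ℝ)) atTop (𝓝 (1 - 0)) :=
      tendsto_const_nhds.sub tendsto_one_div_atTop_nhds_zero_nat
    rw [sub_zero] at htend
    obtain ⟨i, hi, hi1, hi2, hin⟩ := (hD.and ((htend.eventually_const_le hc').and
      ((eventually_ge_atTop 1).and (eventually_ge_atTop n₀)))).exists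
    refine ⟨i * m i, ?_, hi1.trans ?_⟩
    · nlinarith [hm i]
    · have hsub : (Finset.Ioc (m i) (i * m i) : Set ℕ) ⊆ D ∩ Set.Icc 1 (i * m i) := by
        intro k hk
        rw [Finset.coe_Ioc, Set.mem_Ioc] at hk
        exact ⟨hi k hk.1 hk.2, by omega, hk.2⟩
      have hcard := Set.ncard_le_ncard hsub ((Set.finite_Icc _ _).subset Set.inter_subset_right)
      rw [Set.ncard_coe_finset, Nat.card_Ioc] at hcard
      have hmi : (0 : ℝ) < m i := by exact_mod_cast (hi2.trans (hm i))
      have hipos : (0 : ℝ) < i := by exact_mod_cast hi2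
      have hcard' : (i : ℝ) * m i - m i ≤ ((D ∩ Set.Icc 1 (i * m i)).ncard : ℝ) := by
        have : i * m i ≤ (D ∩ Set.Icc 1 (i * m i)).ncard + m i := by omega
        have : (i : ℝ) * m i ≤ ((D ∩ Set.Icc 1 (i * m i)).ncard : ℝ) + m i := by
          exact_mod_cast this
        linarith
      push_cast
      rw [le_div_iff₀ (by positivity)]
      have : (1 - 1 / (i : ℝ)) * (i * m i) = i * m i - m i := by field_simp
      linarith

/-! ### A scrambled set from a single irregular orbit -/

section Criterion

variable {𝕜 X : Type*} [RCLike 𝕜] [NormedAddCommGroup X] [NormedSpace 𝕜 X]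

theorem MLO.pow_graph_unique (T : X →ₗ.[𝕜] X) (k : ℕ) {x u v : X}
    (hu : (x, u) ∈ MLO.pow T.graph k) (hv : (x, v) ∈ MLO.pow T.graph k) : u = v := by
  induction k generalizing u v with
  | zero =>
    have hu' : u = x := by simpa [MLO.pow] using hu
    have hv' : v = x := by simpa [MLO.pow] using hv
    rw [hu', hv']
  | succ k ih =>
    obtain ⟨y, hy, hyu⟩ := hu
    obtain ⟨y', hy', hyv⟩ := hv
    obtain rfl : y = y' := ih hy hy'
    exact T.mem_graph_snd_inj hyu hyv rfl

/-- Suppose that the joint orbit `o` of one vector `z` is large on the windows `(p i, i * p i]` and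
small on the windows `(q i, i * q i]`, and that there is a dense sequence `d` of vectors with
eventually vanishing orbits. The vectors `t • z + d l`, where `l` depends on `t ∈ (0, 1)` and takes
each value for arbitrarily small `t`, form an uncountable dense set. The orbit of the difference of
two of them is eventually a nonzero multiple of that of `z`, so the set is scrambled, with any
separation constant. -/
theorem isDenselyD1DistribChaotic_of_irregular_orbit {N : ℕ} (hN : 0 < N)
    (T : Fin N → (X →ₗ.[𝕜] X)) {z : X} {o : Fin N → ℕ → X}
    (ho : ∀ j k, (z, o j k) ∈ MLO.pow (T j).graph k)
    {p q : ℕ → ℕ} (hp : ∀ i, i ≤ p i) (hq : ∀ i, i ≤ q i)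
    (hlarge : ∀ i j k, p i < k → k ≤ i * p i → (i : ℝ) ≤ ‖o j k‖)
    (hsmall : ∀ i j k, q i < k → k ≤ i * q i → ‖o j k‖ ≤ 1 / ((i : ℝ) + 1))
    {d : ℕ → X} (hd : DenseRange d) {od : ℕ → Fin N → ℕ → X}
    (hod : ∀ l j k, (d l, od l j k) ∈ MLO.pow (T j).graph k)
    (hod0 : ∀ l j, ∀ᶠ k in atTop, od l j k = 0) :
    IsDenselyD1DistribChaotic T := by
  set L : ℝ → ℕ := fun t => (Nat.unpair ⌊1 / t⌋₊).1 with hL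
  set φ : ℝ → X := fun t => (t : 𝕜) • z + d (L t) with hφ
  set O : ℝ → Fin N → ℕ → X := fun t j k => (t : 𝕜) • o j k + od (L t) j k with hO
  have hφO : ∀ t j k, (φ t, O t j k) ∈ MLO.pow (T j).graph k := fun t j k =>
    Submodule.add_mem _ (Submodule.smul_mem _ (t : 𝕜) (ho j k)) (hod (L t) j k)
  have hdist : ∀ t s, ∀ᶠ k in atTop, ∀ j, dist (O t j k) (O s j k) = |t - s| * ‖o j k‖ := by
    intro t s
    filter_upwards [eventually_all.2 (hod0 (L t)), eventually_all.2 (hod0 (L s))] with k h1 h2 j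
    rw [dist_eq_norm]
    simp only [hO]
    rw [h1, h2, add_zero, add_zero, ← sub_smul, norm_smul, ← RCLike.ofReal_sub,
      RCLike.norm_ofReal]
  have hwin : ∀ {P : ℕ → Prop} {m : ℕ → ℕ}, (∀ i, i ≤ m i) → (∀ᶠ k in atTop, P k) →
      ∀ᶠ i in atTop, ∀ k, m i < k → P k := by
    intro P m hm hP
    obtain ⟨K, hK⟩ := eventually_atTop.1 hP
    filter_upwards [eventually_ge_atTop K] with i hi k hk
    exact hK k (hi.trans ((hm i).trans hk.le))
  have hfar : ∀ t s, t ≠ s → ∀ᶠ i in atTop, ∀ k, p i < k → k ≤ i * p i → ∀ j,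
      1 ≤ dist (O t j k) (O s j k) := by
    intro t s hts
    have hpos : 0 < |t - s| := abs_pos.2 (sub_ne_zero.2 hts)
    filter_upwards [hwin hp (hdist t s),
      tendsto_natCast_atTop_atTop.eventually_ge_atTop (1 / |t - s|)] with i hi hi' k hk hk' j
    rw [hi k hk j]
    rw [div_le_iff₀ hpos] at hi'
    nlinarith [hlarge i j k hk hk']
  have hinj : ∀ t s, φ t = φ s → t = s := by
    intro t s h
    by_contra hts
    obtain ⟨i, hi, hi2⟩ := ((hfar t s hts).and (eventually_ge_atTop 2)).exists
    have hk := hi (i * p i) (by nlinarith [hp i]) le_rfl ⟨0, hN⟩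
    have := MLO.pow_graph_unique _ _ (hφO t ⟨0, hN⟩ (i * p i)) (h ▸ hφO s ⟨0, hN⟩ (i * p i))
    rw [this, dist_self] at hk
    linarith
  refine ⟨φ '' Set.Ioo 0 1, ?_, ?_, ?_, 1, one_pos, ?_⟩
  · intro hc
    have hc' := Set.countable_of_injective_of_countable_image
      (fun t _ s _ h => hinj t s h) hc
    rw [← Cardinal.le_aleph0_iff_set_countable, Cardinal.mk_Ioo_real zero_lt_one] at hc'
    exact absurd hc' (not_le.2 Cardinal.aleph0_lt_continuum)
  · rw [Metric.dense_iff]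
    intro x ε hε
    obtain ⟨l, hl⟩ := hd.exists_dist_lt x (half_pos hε)
    -- The parameters `t = 1 / Nat.pair l m` all select `d l`, and tend to `0` with `m → ∞`.
    obtain ⟨m, hm2, hm⟩ := ((eventually_ge_atTop 2).and
      (tendsto_natCast_atTop_atTop.eventually_gt_atTop (‖z‖ / (ε / 2)))).exists
    have hpair : m ≤ Nat.pair l m := Nat.right_le_pair l m
    have hmR : (2 : ℝ) ≤ Nat.pair l m := by exact_mod_cast hm2.trans hpair
    have hmR' : (m : ℝ) ≤ Nat.pair l m := by exact_mod_cast hpair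
    refine ⟨φ (1 / (Nat.pair l m : ℝ)), ?_, _, ⟨by positivity, ?_⟩, rfl⟩
    · have hLl : L (1 / (Nat.pair l m : ℝ)) = l := by
        simp only [hL, one_div_one_div, Nat.floor_natCast, Nat.unpair_pair]
      have hz : ‖((1 / (Nat.pair l m : ℝ) : ℝ) : 𝕜) • z‖ < ε / 2 := by
        rw [norm_smul, RCLike.norm_ofReal, abs_of_pos (by positivity), one_div_mul_eq_div,
          div_lt_iff₀ (by positivity)]
        rw [div_lt_iff₀ (half_pos hε)] at hm
        nlinarith
      rw [Metric.mem_ball]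
      calc dist (φ (1 / (Nat.pair l m : ℝ))) x
          ≤ dist (φ (1 / (Nat.pair l m : ℝ))) (d l) + dist (d l) x := dist_triangle _ _ _
        _ < ε / 2 + ε / 2 := by
          refine add_lt_add ?_ (by rwa [dist_comm])
          simp only [hφ]
          rw [hLl, dist_eq_norm, add_sub_cancel_right]
          exact hz
        _ = ε := add_halves ε
    · rw [div_lt_one (by linarith)]
      linarith
  · rintro j k - _ ⟨t, -, rfl⟩
    exact ⟨_, hφO t j k⟩
  · rintro ε hε _ ⟨t, -, rfl⟩ _ ⟨s, -, rfl⟩ hne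
    have hts : t ≠ s := fun h => hne (h ▸ rfl)
    refine ⟨O t, O s, fun j k _ => ⟨hφO t j k, hφO s j k⟩, ?_, ?_⟩
    · refine upperDens_eq_one_of_windows hp ?_
      filter_upwards [hfar t s hts] with i hi k hk hk'
      exact Set.mem_iInter.2 fun j => hi k hk hk' j
    · refine upperDens_eq_one_of_windows hq ?_
      have hlim : Tendsto (fun i : ℕ => |t - s| * (1 / ((i : ℝ) + 1))) atTop (𝓝 (|t - s| * 0)) :=
        tendsto_const_nhds.mul tendsto_one_div_add_atTop_nhds_zero_nat
      rw [mul_zero] at hlim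
      filter_upwards [hwin hq (hdist t s), hlim.eventually_lt_const hε] with i hi hi' k hk hk'
      refine Set.mem_iInter.2 fun j => ?_
      change dist (O t j k) (O s j k) < ε
      rw [hi k hk j]
      exact (mul_le_mul_of_nonneg_left (hsmall i j k hk hk') (abs_nonneg _)).trans_lt hi'

end Criterion

/-! ### Summable families of reals -/

/-- A summable series of nonnegative reals stays summable after multiplication by some sequence
tending to infinity. -/
theorem exists_tendsto_atTop_summable_mul {f : ℕ → ℝ} (hf : ∀ n, 0 ≤ f n) (hs : Summable f) :
    ∃ c : ℕ → ℝ, (∀ n, 0 ≤ c n) ∧ Tendsto c atTop atTop ∧ Summable fun n => c n * f n := by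
  -- With `r n` the tail of a positive summable `g ≥ f`, take `c n = 1 / √(r n)`: then
  -- `c n * g n ≤ 2 * (√(r n) - √(r (n + 1)))`, which telescopes.
  set g : ℕ → ℝ := fun n => f n + (1 / 2) ^ n with hg
  have hgpos : ∀ n, 0 < g n := fun n => add_pos_of_nonneg_of_pos (hf n) (by positivity)
  have hgs : Summable g := hs.add summable_geometric_two
  set r : ℕ → ℝ := fun n => ∑' k, g (k + n) with hr
  have hrs : ∀ n, r n = g n + r (n + 1) := by
    intro n
    have h := ((summable_nat_add_iff n).2 hgs).tsum_eq_zero_add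
    simp only [hr]
    rw [h, zero_add]
    congr 1
    exact tsum_congr fun k => by ring_nf
  have hrnonneg : ∀ n, 0 ≤ r n := fun n => tsum_nonneg fun k => (hgpos _).le
  have hrpos : ∀ n, 0 < r n := fun n => by
    rw [hrs n]
    exact add_pos_of_pos_of_nonneg (hgpos n) (hrnonneg _)
  have hsq : ∀ n, 0 < √(r n) := fun n => Real.sqrt_pos.2 (hrpos n)
  refine ⟨fun n => (√(r n))⁻¹, fun n => (inv_pos.2 (hsq n)).le, ?_, ?_⟩
  · have h0 : Tendsto (fun n => √(r n)) atTop (𝓝 0) := by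
      have := (Real.continuous_sqrt.tendsto 0).comp (tendsto_sum_nat_add g)
      rwa [Real.sqrt_zero] at this
    refine tendsto_inv_nhdsGT_zero.comp ?_
    exact tendsto_nhdsWithin_iff.2 ⟨h0, Eventually.of_forall hsq⟩
  · refine summable_of_sum_range_le (c := 2 * √(r 0))
      (fun n => mul_nonneg (inv_pos.2 (hsq n)).le (hf n)) fun n => ?_
    have hterm : ∀ i, (√(r i))⁻¹ * f i ≤ 2 * (√(r i) - √(r (i + 1))) := by
      intro i
      have h1 : f i ≤ g i := le_add_of_nonneg_right (by positivity)
      have h2 : g i = √(r i) ^ 2 - √(r (i + 1)) ^ 2 := by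
        rw [Real.sq_sqrt (hrnonneg _), Real.sq_sqrt (hrnonneg _), hrs i]
        ring
      have h3 : √(r (i + 1)) ≤ √(r i) :=
        Real.sqrt_le_sqrt (by rw [hrs i]; linarith [hgpos i])
      rw [inv_mul_le_iff₀ (hsq i)]
      nlinarith [hsq i, hsq (i + 1)]
    calc ∑ i ∈ Finset.range n, (√(r i))⁻¹ * f i
        ≤ ∑ i ∈ Finset.range n, 2 * (√(r i) - √(r (i + 1))) :=
          Finset.sum_le_sum fun i _ => hterm i
      _ = 2 * (√(r 0) - √(r n)) := by
          rw [← Finset.mul_sum, Finset.sum_range_sub' fun i => √(r i)]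
      _ ≤ 2 * √(r 0) := by linarith [hsq n]

/-- Every nonnegative summable family is dominated by a summable family pulled back along a given
map, namely by the sums over its fibres. -/
theorem exists_summable_le_comp {ι β : Type*} {g : ι → ℝ} (hg : ∀ i, 0 ≤ g i) (hs : Summable g)
    (m : ι → β) : ∃ h : β → ℝ, (∀ b, 0 ≤ h b) ∧ Summable h ∧ ∀ i, g i ≤ h (m i) := by
  refine ⟨fun b => ∑' i : {i // m i = b}, g i, fun b => tsum_nonneg fun i => hg i, ?_, fun i => ?_⟩
  · exact ((Equiv.sigmaFiberEquiv m).summable_iff.2 hs).sigma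
  · exact (hs.subtype _).le_tsum (⟨i, rfl⟩ : {l // m l = m i}) fun l _ => hg l

/-! ### Solid sequence spaces -/

/-- A normed space of sequences, given by its coordinate map, whose norm dominates the coordinates,
is solid, does not increase under backward shifts, and is order continuous. -/
structure SolidSequenceSpace {𝕜 X : Type*} [RCLike 𝕜] [NormedAddCommGroup X] [NormedSpace 𝕜 X]
    (coord : X →ₗ[𝕜] (ℕ → 𝕜)) : Prop where
  injective : Function.Injective coord
  norm_coord_le : ∀ x n, ‖coord x n‖ ≤ ‖x‖
  /-- A sequence dominated by a multiple of a backward shift of a member is a member, with the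
  corresponding bound for the norm. -/
  exists_of_le : ∀ (x : X) (k : ℕ) (c : ℝ) (f : ℕ → 𝕜), 0 ≤ c →
    (∀ n, ‖f n‖ ≤ c * ‖coord x (n + k)‖) → ∃ x', coord x' = f ∧ ‖x'‖ ≤ c * ‖x‖
  /-- Order continuity of the norm, in the form that the tails of a member are uniformly small. -/
  exists_tail_le : ∀ (x : X) (ε : ℝ), 0 < ε → ∃ r : ℕ, ∀ x', (∀ n < r, coord x' n = 0) →
    (∀ n, ‖coord x' n‖ ≤ ‖coord x n‖) → ‖x'‖ ≤ ε

namespace SolidSequenceSpace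

variable {𝕜 X : Type*} [RCLike 𝕜] [NormedAddCommGroup X] [NormedSpace 𝕜 X]
  {coord : X →ₗ[𝕜] (ℕ → 𝕜)}

theorem exists_denseRange_finite_support (hX : SolidSequenceSpace coord)
    (hne : ∀ n, ∃ x, coord x n ≠ 0) :
    ∃ d : ℕ → X, DenseRange d ∧ ∀ l, ∃ r, ∀ n, r ≤ n → coord (d l) n = 0 := by
  have hunit : ∀ n, ∃ e, coord e = Pi.single n (1 : 𝕜) := by
    intro n
    obtain ⟨x, hx⟩ := hne n
    obtain ⟨e, he, -⟩ := hX.exists_of_le x 0 ‖coord x n‖⁻¹ (Pi.single n (1 : 𝕜))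
      (inv_nonneg.2 (norm_nonneg _)) fun l => by
        rcases eq_or_ne l n with rfl | hl
        · rw [Pi.single_eq_same, norm_one, add_zero, inv_mul_cancel₀ (norm_ne_zero_iff.2 hx)]
        · rw [Pi.single_eq_of_ne hl, norm_zero]
          positivity
    exact ⟨e, he⟩
  choose e he using hunit
  set F : Submodule 𝕜 X := Submodule.span 𝕜 (Set.range e) with hF
  have hFsupp : ∀ x ∈ F, ∃ r, ∀ n, r ≤ n → coord x n = 0 := by
    intro x hx
    induction hx using Submodule.span_induction with
    | mem x h =>
      obtain ⟨n, rfl⟩ := h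
      exact ⟨n + 1, fun l hl => by rw [he, Pi.single_eq_of_ne (by omega)]⟩
    | zero => exact ⟨0, fun n _ => by simp⟩
    | add x y _ _ hx hy =>
      obtain ⟨r, hr⟩ := hx
      obtain ⟨s, hs⟩ := hy
      refine ⟨max r s, fun n hn => ?_⟩
      rw [map_add, Pi.add_apply, hr n (le_of_max_le_left hn), hs n (le_of_max_le_right hn),
        add_zero]
    | smul c x _ hx =>
      obtain ⟨r, hr⟩ := hx
      exact ⟨r, fun n hn => by rw [map_smul, Pi.smul_apply, hr n hn, smul_zero]⟩
  have hFdense : Dense (F : Set X) := by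
    rw [Metric.dense_iff]
    intro x ε hε
    obtain ⟨r, hr⟩ := hX.exists_tail_le x (ε / 2) (half_pos hε)
    set y : X := ∑ n ∈ Finset.range r, coord x n • e n with hy
    have hyF : y ∈ F := Submodule.sum_mem _ fun n _ =>
      Submodule.smul_mem _ _ (Submodule.subset_span ⟨n, rfl⟩)
    have hyc : ∀ n, coord y n = if n < r then coord x n else 0 := by
      intro n
      rw [hy, map_sum, Finset.sum_apply]
      simp [he, Pi.single_apply]
    refine ⟨y, ?_, hyF⟩
    rw [Metric.mem_ball, dist_comm, dist_eq_norm]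
    refine (hr (x - y) (fun n hn => ?_) fun n => ?_).trans_lt (half_lt_self hε)
    · rw [map_sub, Pi.sub_apply, hyc, if_pos hn, sub_self]
    · rw [map_sub, Pi.sub_apply, hyc]
      split_ifs <;> simp
  have hsep : TopologicalSpace.IsSeparable (F : Set X) :=
    TopologicalSpace.IsSeparable.span (Set.countable_range e).isSeparable
  have := hsep.separableSpace
  have : Nonempty (F : Set X) := ⟨⟨0, F.zero_mem⟩⟩
  refine ⟨fun l => (TopologicalSpace.denseSeq (F : Set X) l : X), ?_, fun l =>
    hFsupp _ (TopologicalSpace.denseSeq (F : Set X) l).2⟩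
  exact hFdense.denseRange_val.comp (TopologicalSpace.denseRange_denseSeq _) continuous_subtype_val

/-- The orbit of `x` under a weighted backward shift, read off from the coordinates. -/
theorem mem_pow_graph (hX : SolidSequenceSpace coord) {T : X →ₗ.[𝕜] X} {w : ℕ → ℝ}
    (hT : ∀ x y, (∀ n, coord y n = (w n : 𝕜) * coord x (n + 1)) → (x, y) ∈ T.graph)
    {x : X} {o : ℕ → X}
    (ho : ∀ k n, coord (o k) n = ((∏ i ∈ Finset.Ico n (n + k), w i : ℝ) : 𝕜) * coord x (n + k))
    (k : ℕ) : (x, o k) ∈ MLO.pow T.graph k := by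
  induction k with
  | zero =>
    have h : o 0 = x := hX.injective (funext fun n => by simp [ho])
    simp [MLO.pow, h]
  | succ k ih =>
    refine ⟨o k, ih, hT _ _ fun n => ?_⟩
    rw [ho, ho, Finset.prod_eq_prod_Ico_succ_bot (by omega), RCLike.ofReal_mul, mul_assoc,
      show n + 1 + k = n + (k + 1) by omega]

/-- A vector `y` that meets, for each large `k` and each `j`, a near-maximal entry of the `k`-th
weight `W j k` in a coordinate large enough to make the product tend to infinity. The coordinate
`n + k` of `y` only has to dominate `(c k / (⨆ n, W j k n) ^ q) ^ (1 / q)` for the indices `k` whose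
near-maximal entry is at `n`, and these demands have summable `q`-th powers. -/
theorem exists_large_coord {q : ℕ} (hq : q ≠ 0)
    (hgen : ∀ h : ℕ → ℝ, (∀ n, 0 ≤ h n) → Summable h → ∃ y, ∀ n, h n ≤ ‖coord y n‖ ^ q)
    {N : ℕ} {W : Fin N → ℕ → ℕ → ℝ} (hW : ∀ j k n, 0 < W j k n)
    (hWb : ∀ j k, 1 ≤ k → BddAbove (Set.range (W j k)))
    (hsum : ∀ j, Summable fun k => 1 / (⨆ n, W j (k + 1) n) ^ q) :
    ∃ (y : X) (s : Fin N → ℕ → ℕ), ∀ R : ℝ, ∀ᶠ k in atTop, ∀ j,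
      R ≤ W j k (s j k) * ‖coord y (s j k + k)‖ := by
  set B : Fin N → ℕ → ℝ := fun j k => ⨆ n, W j k n with hB
  have hBpos : ∀ j k, 1 ≤ k → 0 < B j k := fun j k hk =>
    (hW j k 0).trans_le (le_ciSup (hWb j k hk) 0)
  have hs : ∀ j k, ∃ n, 1 ≤ k → B j k / 2 < W j k n := by
    intro j k
    by_cases hk : 1 ≤ k
    · obtain ⟨n, hn⟩ := exists_lt_of_lt_ciSup (half_lt_self (hBpos j k hk))
      exact ⟨n, fun _ => hn⟩
    · exact ⟨0, fun h => absurd h hk⟩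
  choose s hs using hs
  have hfnonneg : ∀ j k, 0 ≤ 1 / B j (k + 1) ^ q := fun j k =>
    one_div_nonneg.2 (pow_nonneg (hBpos j _ (by omega)).le q)
  obtain ⟨c, hc0, hc, hcs⟩ := exists_tendsto_atTop_summable_mul
    (fun k => Finset.sum_nonneg fun j _ => hfnonneg j k)
    (summable_sum (s := Finset.univ) fun j _ => hsum j)
  have hcj : ∀ j, Summable fun k => c k * (1 / B j (k + 1) ^ q) := fun j =>
    hcs.of_nonneg_of_le (fun k => mul_nonneg (hc0 k) (hfnonneg j k)) fun k =>
      mul_le_mul_of_nonneg_left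
        (Finset.single_le_sum (fun j _ => hfnonneg j k) (Finset.mem_univ j)) (hc0 k)
  choose h hh0 hhs hh using fun j => exists_summable_le_comp
    (fun k => mul_nonneg (hc0 k) (hfnonneg j k)) (hcj j) fun k => s j (k + 1) + (k + 1)
  obtain ⟨y, hy⟩ := hgen (fun n => ∑ j, h j n) (fun n => Finset.sum_nonneg fun j _ => hh0 j n)
    (summable_sum fun j _ => hhs j)
  refine ⟨y, s, fun R => ?_⟩
  obtain ⟨K, hK⟩ := eventually_atTop.1 (hc.eventually_ge_atTop ((2 * max R 0) ^ q))
  filter_upwards [eventually_ge_atTop (K + 1)] with k hk j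
  obtain ⟨k, rfl⟩ : ∃ l, k = l + 1 := ⟨k - 1, by omega⟩
  have hb := hBpos j (k + 1) (by omega)
  have hsk := hs j (k + 1) (by omega)
  set t := ‖coord y (s j (k + 1) + (k + 1))‖ with ht
  have ht0 : 0 ≤ t := norm_nonneg _
  have h1 : c k * (1 / B j (k + 1) ^ q) ≤ t ^ q :=
    (hh j k).trans ((Finset.single_le_sum (fun j _ => hh0 j _) (Finset.mem_univ j)).trans (hy _))
  rw [mul_one_div, div_le_iff₀ (pow_pos hb q), ← mul_pow] at h1
  have h2 : (2 * max R 0) ^ q ≤ (2 * (W j (k + 1) (s j (k + 1)) * t)) ^ q := by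
    refine ((hK k (by omega)).trans h1).trans (pow_le_pow_left₀ (by positivity) ?_ q)
    nlinarith
  have h3 := (pow_le_pow_iff_left₀ (by positivity)
    (mul_nonneg zero_le_two (mul_nonneg (hW _ _ _).le ht0)) hq).1 h2
  linarith [le_max_left R 0]

/-- Restricting `y` to a sparse union of blocks `[r i, M i]` makes its orbit oscillate. The block
`[r i, M i]` contains all coordinates needed for a large orbit at times `k ∈ (r i, i * r i]`. At
times `k > M i` the orbit only sees the later blocks, and `r (i + 1)` is so large that they are
negligible up to the time `i * M i`. -/
theorem exists_block_restriction (hX : SolidSequenceSpace coord) {N : ℕ}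
    {W : Fin N → ℕ → ℕ → ℝ} (hW : ∀ j k n, 0 < W j k n)
    {b : Fin N → ℕ → ℝ} (hb : ∀ j k n, W j k n ≤ b j k) {y : X} {s : Fin N → ℕ → ℕ}
    (hy : ∀ R : ℝ, ∀ᶠ k in atTop, ∀ j, R ≤ W j k (s j k) * ‖coord y (s j k + k)‖) :
    ∃ (z : X) (p q : ℕ → ℕ), (∀ i, i ≤ p i) ∧ (∀ i, i ≤ q i) ∧
      ∀ o : Fin N → ℕ → X, (∀ j k n, ‖coord (o j k) n‖ = W j k n * ‖coord z (n + k)‖) →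
        (∀ i j k, p i < k → k ≤ i * p i → (i : ℝ) ≤ ‖o j k‖) ∧
        ∀ i j k, q i < k → k ≤ i * q i → ‖o j k‖ ≤ 1 / ((i : ℝ) + 1) := by
  have hb0 : ∀ j k, 0 ≤ b j k := fun j k => (hW j k 0).le.trans (hb j k 0)
  have hstart : ∀ i M : ℕ, ∃ r, i ≤ r ∧ M < r ∧
      (∀ k, r ≤ k → ∀ j, (i : ℝ) ≤ W j k (s j k) * ‖coord y (s j k + k)‖) ∧
      ∀ x', (∀ n < r, coord x' n = 0) → (∀ n, ‖coord x' n‖ ≤ ‖coord y n‖) →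
        ∀ j k, k ≤ i * M → b j k * ‖x'‖ ≤ 1 / ((i : ℝ) + 1) := by
    intro i M
    set c : ℝ := 1 + ∑ j, ∑ k ∈ Finset.range (i * M + 1), b j k with hc
    have hbc : ∀ j k, k ≤ i * M → b j k ≤ c := by
      intro j k hk
      have h1 : b j k ≤ ∑ k ∈ Finset.range (i * M + 1), b j k :=
        Finset.single_le_sum (fun k _ => hb0 j k) (Finset.mem_range.2 (by omega))
      have h2 := Finset.single_le_sum
        (f := fun j => ∑ k ∈ Finset.range (i * M + 1), b j k)
        (fun j _ => Finset.sum_nonneg fun k _ => hb0 j k) (Finset.mem_univ j)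
      linarith
    have hcpos : 0 < c := by
      have : 0 ≤ ∑ j, ∑ k ∈ Finset.range (i * M + 1), b j k :=
        Finset.sum_nonneg fun j _ => Finset.sum_nonneg fun k _ => hb0 j k
      linarith
    obtain ⟨K, hK⟩ := eventually_atTop.1 (hy i)
    obtain ⟨t, ht⟩ := hX.exists_tail_le y (1 / ((i : ℝ) + 1) / c) (by positivity)
    refine ⟨i + (M + 1) + K + t, by omega, by omega, fun k hk => hK k (by omega), ?_⟩
    intro x' h0 hle j k hk
    have h := ht x' (fun n hn => h0 n (by omega)) hle
    calc b j k * ‖x'‖ ≤ c * (1 / ((i : ℝ) + 1) / c) :=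
          mul_le_mul (hbc j k hk) h (norm_nonneg _) hcpos.le
      _ = 1 / ((i : ℝ) + 1) := mul_div_cancel₀ _ hcpos.ne'
  have hend : ∀ i r : ℕ, ∃ M, r ≤ M ∧ ∀ j k, k ≤ i * r → s j k + k ≤ M := by
    intro i r
    refine ⟨r + ∑ j, ∑ k ∈ Finset.range (i * r + 1), (s j k + k), by omega, fun j k hk => ?_⟩
    have h1 : s j k + k ≤ ∑ k ∈ Finset.range (i * r + 1), (s j k + k) :=
      Finset.single_le_sum (f := fun k => s j k + k) (fun k _ => Nat.zero_le _)
        (Finset.mem_range.2 (by omega))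
    have h2 := Finset.single_le_sum
      (f := fun j => ∑ k ∈ Finset.range (i * r + 1), (s j k + k))
      (fun j _ => Nat.zero_le _) (Finset.mem_univ j)
    omega
  choose R hRi hRM hRlarge hRtail using hstart
  choose E hEr hE using hend
  set r : ℕ → ℕ := fun i => Nat.rec (R 0 0) (fun i ri => R (i + 1) (E i ri)) i with hr
  set M : ℕ → ℕ := fun i => E i (r i) with hM
  have hrsucc : ∀ i, r (i + 1) = R (i + 1) (M i) := fun i => rfl
  have hrex : ∀ i, ∃ L, r i = R i L := by
    rintro (_ | i)
    · exact ⟨0, rfl⟩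
    · exact ⟨M i, rfl⟩
  have hir : ∀ i, i ≤ r i := by
    intro i
    obtain ⟨L, hL⟩ := hrex i
    rw [hL]
    exact hRi i L
  have hrM : ∀ i, r i ≤ M i := fun i => hEr i (r i)
  have hMr : ∀ i, M i < r (i + 1) := fun i => hRM (i + 1) (M i)
  have hrmono : Monotone r := monotone_nat_of_le_succ fun i => (hrM i).trans (hMr i).le
  have hMmono : Monotone M := monotone_nat_of_le_succ fun i => (hMr i).le.trans (hrM (i + 1))
  set S : Set ℕ := {n | ∃ i, r i ≤ n ∧ n ≤ M i} with hS
  have hgap : ∀ i n, n ∈ S → M i < n → r (i + 1) ≤ n := by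
    rintro i n ⟨l, hl1, hl2⟩ hn
    have hil : i < l := by
      by_contra hil
      exact absurd (hl2.trans (hMmono (not_lt.1 hil))) (not_le.2 hn)
    exact (hrmono hil).trans hl1
  obtain ⟨z, hz, -⟩ := hX.exists_of_le y 0 1 (S.indicator (coord y)) zero_le_one fun n => by
    rw [one_mul, add_zero]
    exact norm_indicator_le_norm_self _ _
  refine ⟨z, r, M, hir, fun i => (hir i).trans (hrM i), fun o ho => ⟨?_, ?_⟩⟩
  · intro i j k hk hk'
    have hmem : s j k + k ∈ S :=
      ⟨i, hk.le.trans (Nat.le_add_left _ _), hE i (r i) j k hk'⟩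
    have hbig : (i : ℝ) ≤ W j k (s j k) * ‖coord y (s j k + k)‖ := by
      obtain ⟨L, hL⟩ := hrex i
      exact hRlarge i L k (hL ▸ hk.le) j
    calc (i : ℝ) ≤ W j k (s j k) * ‖coord y (s j k + k)‖ := hbig
      _ = ‖coord (o j k) (s j k)‖ := by rw [ho, hz, Set.indicator_of_mem hmem]
      _ ≤ ‖o j k‖ := hX.norm_coord_le _ _
  · intro i j k hk hk'
    obtain ⟨x, hx, -⟩ := hX.exists_of_le y 0 1 ((S ∩ Set.Ioi (M i)).indicator (coord y))
      zero_le_one fun n => by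
        rw [one_mul, add_zero]
        exact norm_indicator_le_norm_self _ _
    have hsmall := hRtail (i + 1) (M i) x (fun n hn => by
        rw [hx, Set.indicator_of_notMem]
        rintro ⟨hnS, hnM⟩
        exact absurd (hgap i n hnS hnM) (not_le.2 (hrsucc i ▸ hn)))
      (fun n => by
        rw [hx]
        exact norm_indicator_le_norm_self _ _) j k (hk'.trans (Nat.mul_le_mul_right _ (by omega)))
    obtain ⟨o', ho', hle⟩ := hX.exists_of_le x k (b j k) (coord (o j k)) (hb0 j k) fun n => by
      have hxz : coord x (n + k) = coord z (n + k) := by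
        have hmem : n + k ∈ Set.Ioi (M i) := by
          rw [Set.mem_Ioi]
          omega
        rw [hx, hz]
        by_cases hnS : n + k ∈ S
        · rw [Set.indicator_of_mem (Set.mem_inter hnS hmem), Set.indicator_of_mem hnS]
        · rw [Set.indicator_of_notMem (fun h => hnS h.1), Set.indicator_of_notMem hnS]
      rw [ho, hxz]
      exact mul_le_mul_of_nonneg_right (hb j k n) (norm_nonneg _)
    rw [← hX.injective ho']
    refine (hle.trans hsmall).trans (one_div_le_one_div_of_le (by positivity) ?_)
    push_cast
    linarith

theorem isDenselyD1DistribChaotic (hX : SolidSequenceSpace coord) {q : ℕ} (hq : q ≠ 0)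
    (hgen : ∀ h : ℕ → ℝ, (∀ n, 0 ≤ h n) → Summable h → ∃ y, ∀ n, h n ≤ ‖coord y n‖ ^ q)
    {N : ℕ} (hN : 0 < N) {w : Fin N → ℕ → ℝ} (hw : ∀ j n, 0 < w j n)
    {a : ℕ → ℝ} (ha : ∀ n, 0 < a n) (ha_bdd : BddAbove (Set.range a))
    (hB : ∀ j, ∀ k : ℕ, 1 ≤ k →
      BddAbove (Set.range fun n : ℕ => a (k + n) * ∏ i ∈ Finset.Ico n (k + n), w j i))
    (hsum : ∀ j, Summable fun k : ℕ => 1 / shiftSup (w j) a (k + 1) ^ q)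
    {T : Fin N → (X →ₗ.[𝕜] X)}
    (hT : ∀ j x y, (∀ n, coord y n = (w j n : 𝕜) * coord x (n + 1)) → (x, y) ∈ (T j).graph) :
    IsDenselyD1DistribChaotic T := by
  set W : Fin N → ℕ → ℕ → ℝ := fun j k n => a (k + n) * ∏ i ∈ Finset.Ico n (k + n), w j i with hW
  have hWpos : ∀ j k n, 0 < W j k n := fun j k n =>
    mul_pos (ha _) (Finset.prod_pos fun i _ => hw j i)
  have hWb : ∀ j k, ∃ b, ∀ n, W j k n ≤ b := by
    intro j k
    rcases Nat.eq_zero_or_pos k with rfl | hk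
    · obtain ⟨b, hb⟩ := ha_bdd
      refine ⟨b, fun n => ?_⟩
      simpa [hW] using hb ⟨n, rfl⟩
    · obtain ⟨b, hb⟩ := hB j k hk
      exact ⟨b, fun n => hb ⟨n, rfl⟩⟩
  choose b hb using hWb
  obtain ⟨y, s, hys⟩ := exists_large_coord (coord := coord) hq hgen hWpos hB hsum
  obtain ⟨x, p, r, hp, hr, hpr⟩ := hX.exists_block_restriction hWpos hb hys
  -- The irregular vector is `z = a * x`; the factor `a` makes the whole orbit of `z` exist.
  obtain ⟨A, hA⟩ := ha_bdd
  have hA0 : 0 ≤ A := (ha 0).le.trans (hA ⟨0, rfl⟩)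
  obtain ⟨z, hz, -⟩ := hX.exists_of_le x 0 A (fun n => (a n : 𝕜) * coord x n) hA0 fun n => by
    rw [norm_mul, RCLike.norm_ofReal, abs_of_pos (ha n), add_zero]
    exact mul_le_mul_of_nonneg_right (hA ⟨n, rfl⟩) (norm_nonneg _)
  have ho : ∀ j k, ∃ o, coord o = fun n => (W j k n : 𝕜) * coord x (n + k) := by
    intro j k
    obtain ⟨o, ho, -⟩ := hX.exists_of_le x k (b j k) (fun n => (W j k n : 𝕜) * coord x (n + k))
      ((hWpos j k 0).le.trans (hb j k 0)) fun n => by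
        rw [norm_mul, RCLike.norm_ofReal, abs_of_pos (hWpos j k n)]
        exact mul_le_mul_of_nonneg_right (hb j k n) (norm_nonneg _)
    exact ⟨o, ho⟩
  choose o ho using ho
  obtain ⟨hlarge, hsmall⟩ := hpr o fun j k n => by
    rw [ho, norm_mul, RCLike.norm_ofReal, abs_of_pos (hWpos j k n)]
  have hne : ∀ n, ∃ v, coord v n ≠ 0 := by
    intro n
    obtain ⟨v, hv⟩ := hgen (Pi.single n 1) (fun l => by
      rcases eq_or_ne l n with rfl | hl
      · simp
      · simp [Pi.single_eq_of_ne hl]) (summable_of_hasFiniteSupport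
        ((Set.finite_singleton n).subset Pi.support_single_subset))
    refine ⟨v, fun h0 => ?_⟩
    have := hv n
    rw [Pi.single_eq_same, h0, norm_zero, zero_pow hq] at this
    linarith
  obtain ⟨d, hd, hdsupp⟩ := hX.exists_denseRange_finite_support hne
  choose m hm using hdsupp
  have hod : ∀ l j k, ∃ v, coord v = fun n =>
      ((∏ i ∈ Finset.Ico n (n + k), w j i : ℝ) : 𝕜) * coord (d l) (n + k) := by
    intro l j k
    have hprod : ∀ n, 0 ≤ ∏ i ∈ Finset.Ico n (n + k), w j i := fun n =>
      Finset.prod_nonneg fun i _ => (hw j i).le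
    obtain ⟨v, hv, -⟩ := hX.exists_of_le (d l) k
      (∑ n ∈ Finset.range (m l), ∏ i ∈ Finset.Ico n (n + k), w j i)
      (fun n => ((∏ i ∈ Finset.Ico n (n + k), w j i : ℝ) : 𝕜) * coord (d l) (n + k))
      (Finset.sum_nonneg fun n _ => hprod n) fun n => by
        rw [norm_mul, RCLike.norm_ofReal, abs_of_nonneg (hprod n)]
        rcases lt_or_ge n (m l) with hn | hn
        · exact mul_le_mul_of_nonneg_right (Finset.single_le_sum
            (f := fun n => ∏ i ∈ Finset.Ico n (n + k), w j i)
            (fun n _ => hprod n) (Finset.mem_range.2 hn)) (norm_nonneg _)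
        · simp [hm l (n + k) (by omega)]
    exact ⟨v, hv⟩
  choose od hodc using hod
  refine isDenselyD1DistribChaotic_of_irregular_orbit hN T (z := z) (o := o) (fun j k => ?_) hp hr
    hlarge hsmall hd (od := od) (fun l j k => ?_) fun l j => ?_
  · refine hX.mem_pow_graph (hT j) (fun k n => ?_) k
    simp only [ho, hz, hW]
    rw [add_comm k n, RCLike.ofReal_mul]
    ring
  · exact hX.mem_pow_graph (hT j) (fun k n => by rw [hodc]) k
  · filter_upwards [eventually_ge_atTop (m l)] with k hk
    refine hX.injective (funext fun n => ?_)
    simp [hodc, hm l (n + k) (by omega)]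

end SolidSequenceSpace

/-! ### The spaces `ℓ^p` and `c₀` -/

section Spaces

variable (𝕜 : Type*) [RCLike 𝕜]

/-- The coordinate map of `ℓ^p`. -/
def lpCoord (p : ℝ≥0∞) : lp (fun _ : ℕ => 𝕜) p →ₗ[𝕜] (ℕ → 𝕜) where
  toFun x := x
  map_add' _ _ := rfl
  map_smul' _ _ := rfl

/-- The coordinate map of `c₀`. -/
def c0Coord : c0 𝕜 →ₗ[𝕜] (ℕ → 𝕜) where
  toFun x := x
  map_add' _ _ := rfl
  map_smul' _ _ := rfl

theorem solidSequenceSpace_lpCoord (p : ℝ≥0∞) [hp : Fact (1 ≤ p)] (hp' : p ≠ ∞) :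
    SolidSequenceSpace (lpCoord 𝕜 p) := by
  have hp0 : p ≠ 0 := (zero_lt_one.trans_le hp.out).ne'
  have hpr : 0 < p.toReal := ENNReal.toReal_pos hp0 hp'
  refine ⟨fun x y h => lp.ext h, fun x n => lp.norm_apply_le_norm hp0 x n, ?_, ?_⟩
  · intro x k c f hc hf
    have hsum : ∀ s : Finset ℕ, ∑ n ∈ s, ‖f n‖ ^ p.toReal ≤ (c * ‖x‖) ^ p.toReal := by
      intro s
      calc ∑ n ∈ s, ‖f n‖ ^ p.toReal
          ≤ ∑ n ∈ s, c ^ p.toReal * ‖x (n + k)‖ ^ p.toReal :=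
            Finset.sum_le_sum fun n _ => by
              rw [← Real.mul_rpow hc (norm_nonneg _)]
              exact Real.rpow_le_rpow (norm_nonneg _) (hf n) hpr.le
        _ = c ^ p.toReal * ∑ n ∈ s.map (addRightEmbedding k), ‖x n‖ ^ p.toReal := by
            rw [← Finset.mul_sum, Finset.sum_map]
            rfl
        _ ≤ c ^ p.toReal * ‖x‖ ^ p.toReal :=
            mul_le_mul_of_nonneg_left (lp.sum_rpow_le_norm_rpow hpr x _)
              (Real.rpow_nonneg hc _)
        _ = (c * ‖x‖) ^ p.toReal := (Real.mul_rpow hc (norm_nonneg _)).symm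
    exact ⟨⟨f, memℓp_gen' hsum⟩, rfl,
      lp.norm_le_of_forall_sum_le hpr (mul_nonneg hc (norm_nonneg _)) hsum⟩
  · intro x ε hε
    obtain ⟨t, ht⟩ := summable_iff_vanishing_norm.1 ((lp.memℓp x).summable hpr) (ε ^ p.toReal)
      (Real.rpow_pos_of_pos hε _)
    obtain ⟨r, hr⟩ := t.exists_nat_subset_range
    refine ⟨r, fun x' h0 hle => lp.norm_le_of_forall_sum_le hpr hε.le fun s => ?_⟩
    have hdisj : Disjoint (s.filter fun n => r ≤ n) t := by
      rw [Finset.disjoint_left]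
      intro n hn hnt
      exact absurd (Finset.mem_range.1 (hr hnt)) (not_lt.2 (Finset.mem_filter.1 hn).2)
    calc ∑ n ∈ s, ‖x' n‖ ^ p.toReal
        = ∑ n ∈ s.filter fun n => r ≤ n, ‖x' n‖ ^ p.toReal := by
          refine (Finset.sum_filter_of_ne fun n _ hn => ?_).symm
          by_contra hnr
          have : x' n = 0 := h0 n (not_le.1 hnr)
          rw [this, norm_zero, Real.zero_rpow hpr.ne'] at hn
          exact hn rfl
      _ ≤ ∑ n ∈ s.filter fun n => r ≤ n, ‖x n‖ ^ p.toReal :=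
          Finset.sum_le_sum fun n _ => Real.rpow_le_rpow (norm_nonneg _) (hle n) hpr.le
      _ ≤ ε ^ p.toReal := (le_abs_self _).trans (ht _ hdisj).le

theorem solidSequenceSpace_c0Coord : SolidSequenceSpace (c0Coord 𝕜) := by
  have hnorm : ∀ (x : c0 𝕜) {C : ℝ}, 0 ≤ C → (∀ n, ‖x n‖ ≤ C) → ‖x‖ ≤ C := by
    intro x C hC h
    rw [← ZeroAtInftyContinuousMap.norm_toBCF_eq_norm]
    exact (BoundedContinuousFunction.norm_le hC).2 h
  have hcoord : ∀ (x : c0 𝕜) n, ‖x n‖ ≤ ‖x‖ := fun x n => x.toBCF.norm_coe_le_norm n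
  have htend : ∀ x : c0 𝕜, Tendsto (fun n => ‖x n‖) atTop (𝓝 0) := by
    intro x
    have h := x.zero_at_infty'
    rw [cocompact_eq_cofinite, Nat.cofinite_eq_atTop] at h
    exact tendsto_zero_iff_norm_tendsto_zero.1 h
  refine ⟨DFunLike.coe_injective, hcoord, ?_, ?_⟩
  · intro x k c f hc hf
    have hf0 : Tendsto f atTop (𝓝 0) := by
      refine squeeze_zero_norm hf ?_
      have h := ((tendsto_add_atTop_iff_nat k).2 (htend x)).const_mul c
      rwa [mul_zero] at h
    refine ⟨⟨⟨f, continuous_of_discreteTopology⟩, ?_⟩, rfl,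
      hnorm _ (mul_nonneg hc (norm_nonneg _)) fun n =>
        (hf n).trans (mul_le_mul_of_nonneg_left (hcoord x _) hc)⟩
    rw [cocompact_eq_cofinite, Nat.cofinite_eq_atTop]
    exact hf0
  · intro x ε hε
    obtain ⟨r, hr⟩ := eventually_atTop.1 ((htend x).eventually_le_const hε)
    refine ⟨r, fun x' h0 hle => hnorm x' hε.le fun n => ?_⟩
    rcases lt_or_ge n r with hn | hn
    · have : x' n = 0 := h0 n hn
      rw [this, norm_zero]
      exact hε.le
    · exact (hle n).trans (hr n hn)

theorem mem_graph_lpBackwardShift (p : ℝ≥0∞) (w : ℕ → ℝ) (x y : lp (fun _ : ℕ => 𝕜) p)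
    (h : ∀ n, lpCoord 𝕜 p y n = (w n : 𝕜) * lpCoord 𝕜 p x (n + 1)) :
    (x, y) ∈ (lpBackwardShift 𝕜 p w).graph := by
  have hx : x ∈ (lpBackwardShift 𝕜 p w).domain := by
    change Memℓp (fun n => (w n : 𝕜) * x (n + 1)) p
    rw [← show ⇑y = fun n => (w n : 𝕜) * x (n + 1) from funext h]
    exact lp.memℓp y
  exact (LinearPMap.mem_graph_iff _).2 ⟨⟨x, hx⟩, rfl, lp.ext (funext fun n => (h n).symm)⟩

theorem mem_graph_c0BackwardShift (w : ℕ → ℝ) (x y : c0 𝕜)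
    (h : ∀ n, c0Coord 𝕜 y n = (w n : 𝕜) * c0Coord 𝕜 x (n + 1)) :
    (x, y) ∈ (c0BackwardShift 𝕜 w).graph := by
  have hx : x ∈ (c0BackwardShift 𝕜 w).domain := by
    change Tendsto (fun n => (w n : 𝕜) * x (n + 1)) atTop (𝓝 0)
    rw [← show ⇑y = fun n => (w n : 𝕜) * x (n + 1) from funext h]
    have h0 := y.zero_at_infty'
    rwa [cocompact_eq_cofinite, Nat.cofinite_eq_atTop] at h0
  exact (LinearPMap.mem_graph_iff _).2 ⟨⟨x, hx⟩, rfl, DFunLike.ext _ _ fun n => (h n).symm⟩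

end Spaces

theorem theorem4p10 (𝕜 : Type*) [RCLike 𝕜] (N : ℕ) (hN : 2 ≤ N)
    (w : Fin N → ℕ → ℝ) (hw : ∀ j n, 0 < w j n)
    (a : ℕ → ℝ) (ha : ∀ n, 0 < a n) (ha_bdd : BddAbove (Set.range a))
    (hB : ∀ j, ∀ k : ℕ, 1 ≤ k →
      BddAbove (Set.range fun n : ℕ => a (k + n) * ∏ i ∈ Finset.Ico n (k + n), w j i)) :
    (∀ (p : ℝ≥0∞) [Fact (1 ≤ p)], p ≠ ∞ → p ≠ 2 →
      (∀ j, Summable fun k : ℕ => 1 / shiftSup (w j) a (k + 1)) →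
        IsDenselyD1DistribChaotic fun j => lpBackwardShift 𝕜 p (w j)) ∧
    ((∀ j, Summable fun k : ℕ => 1 / shiftSup (w j) a (k + 1)) →
        IsDenselyD1DistribChaotic fun j => c0BackwardShift 𝕜 (w j)) ∧
    ((∀ j, Summable fun k : ℕ => 1 / shiftSup (w j) a (k + 1) ^ 2) →
        IsDenselyD1DistribChaotic fun j => lpBackwardShift 𝕜 2 (w j)) := by
  have hN0 : 0 < N := by omega
  refine ⟨fun p _ hp _ hsum => ?_, fun hsum => ?_, fun hsum => ?_⟩
  · refine (solidSequenceSpace_lpCoord 𝕜 p hp).isDenselyD1DistribChaotic one_ne_zero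
      (fun h h0 hs => ?_) hN0 hw ha ha_bdd hB (by simpa only [pow_one] using hsum)
      fun j => mem_graph_lpBackwardShift 𝕜 p (w j)
    have hmem : Memℓp (fun n => (h n : 𝕜)) 1 := memℓp_gen <| by
      simpa [abs_of_nonneg (h0 _)] using hs
    refine ⟨⟨_, hmem.of_exponent_ge (Fact.out : 1 ≤ p)⟩, fun n => ?_⟩
    change h n ≤ ‖(h n : 𝕜)‖ ^ 1
    rw [pow_one, RCLike.norm_ofReal]
    exact le_abs_self _
  · refine (solidSequenceSpace_c0Coord 𝕜).isDenselyD1DistribChaotic one_ne_zero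
      (fun h h0 hs => ?_) hN0 hw ha ha_bdd hB (by simpa only [pow_one] using hsum)
      fun j => mem_graph_c0BackwardShift 𝕜 (w j)
    refine ⟨⟨⟨fun n => (h n : 𝕜), continuous_of_discreteTopology⟩, ?_⟩, fun n => ?_⟩
    · rw [cocompact_eq_cofinite, Nat.cofinite_eq_atTop]
      have := (RCLike.continuous_ofReal (K := 𝕜)).tendsto 0 |>.comp hs.tendsto_atTop_zero
      rwa [RCLike.ofReal_zero] at this
    · change h n ≤ ‖(h n : 𝕜)‖ ^ 1
      rw [pow_one, RCLike.norm_ofReal]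
      exact le_abs_self _
  · refine (solidSequenceSpace_lpCoord 𝕜 2 ENNReal.ofNat_ne_top).isDenselyD1DistribChaotic
      two_ne_zero (fun h h0 hs => ?_) hN0 hw ha ha_bdd hB hsum
      fun j => mem_graph_lpBackwardShift 𝕜 2 (w j)
    have hsq : ∀ n, ‖((√(h n) : ℝ) : 𝕜)‖ ^ 2 = h n := fun n => by
      rw [RCLike.norm_ofReal, sq_abs, Real.sq_sqrt (h0 n)]
    have hmem : Memℓp (fun n => ((√(h n) : ℝ) : 𝕜)) 2 := memℓp_gen <| by
      simpa only [ENNReal.toReal_ofNat, Real.rpow_ofNat, hsq] using hs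
    exact ⟨⟨_, hmem⟩, fun n => (hsq n).ge⟩
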